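/- Let $X$ and $Y$ be connected, locally path-connected, semilocally simply connected topological spaces (not necessarily Hausdorff), let $f\colon X\to Y$ be a continuous map, let $x_0\in X$ and $y_0=f(x_0)$, and let $f_\sharp\colon\pi_1(X,x_0)\to\pi_1(Y,y_0)$ be the induced homomorphism. For a space $Z$, let $\mathrm{Cov}(Z)$ be the category whose objects are the coverings $p\colon E\to Z$ (with $E$ possibly disconnected or empty) and whose morphisms are the continuous maps over $Z$. Call a covering of $Z$ trivial if it is isomorphic in $\mathrm{Cov}(Z)$ to a disjoint union $c\cdot Z$ of copies of $Z$, for some cardinal number $c$ (possibly $c=0$). Let $f^{*}\colon\mathrm{Cov}(Y)\to\mathrm{Cov}(X)$ be the pullback functor, which sends $p\colon E\to Y$ to the first projection of $f^{*}(E)=\{(x,e)\in X\times E : f(x)=p(e)\}$, with the subspace topology, onto $X$, and sends a morphism $t$ to the restriction of $\mathrm{id}_X\times t$. Say that $f^{*}$ has nullity zero if every covering $E$ of $Y$ for which $f^{*}(E)$ is trivial is itself trivial. Then $f^{*}$ has nullity zero if and only if $H=\operatorname{im}(f_\sharp)$ is contranormal in $\pi_1(Y,y_0)$, that is, the normal closure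 of $H$ in $\pi_1(Y,y_0)$ is all of $\pi_1(Y,y_0)$. -/

import Mathlib

open CategoryTheory Topology

universe u

/-- Every point has a neighbourhood `U` such that all loops in `U` based at that point are
null-homotopic in the whole space. -/
class SemilocallySimplyConnectedSpace (Y : Type u) [TopologicalSpace Y] : Prop where
  exists_nhds : ∀ y : Y, ∃ U ∈ 𝓝 y, ∀ γ : Path y y, (∀ t, γ t ∈ U) → γ.Homotopic (Path.refl y)

/-- A subgroup is contranormal if its normal closure is the whole group. -/
def Subgroup.IsContranormal {G : Type u} [Group G] (L : Subgroup G) : Prop :=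
  Subgroup.normalClosure (L : Set G) = ⊤

/-- An (unbased) covering of `Y`; the total space may be disconnected or empty. -/
structure Cov (Y : Type u) [TopologicalSpace Y] where
  /-- the total space -/
  total : Type u
  /-- the topology of the total space -/
  [top : TopologicalSpace total]
  /-- the covering projection -/
  proj : total → Y
  /-- the projection is a covering map -/
  isCoveringMap : IsCoveringMap proj

namespace Cov

attribute [instance] Cov.top

/-- Morphisms of coverings: continuous maps over the base. -/
@[ext]
structure Hom {Y : Type u} [TopologicalSpace Y] (E₁ E₂ : Cov Y) where
  /-- the underlying continuous map -/
  map : C(E₁.total, E₂.total)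
  /-- compatibility with the projections -/
  comm : ∀ e, E₂.proj (map e) = E₁.proj e

/-- The category of coverings of `Y`. -/
instance category (Y : Type u) [TopologicalSpace Y] : Category (Cov Y) where
  Hom E₁ E₂ := Hom E₁ E₂
  id E := ⟨ContinuousMap.id _, fun _ => rfl⟩
  comp s t := ⟨t.map.comp s.map, fun e => (t.comm _).trans (s.comm e)⟩

/-- The projection of a disjoint union of copies of `Y` is a covering map. -/
theorem isCoveringMap_copies (S : Type u) (Y : Type u) [TopologicalSpace Y] :
    IsCoveringMap (fun z : (Σ _ : S, Y) => z.2) := by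
  let _ : TopologicalSpace S := ⊥
  have : DiscreteTopology S := ⟨rfl⟩
  have hc : Continuous (fun z : (Σ _ : S, Y) => z.2) := continuous_sigma fun _ => continuous_id
  have hs : Continuous (fun z : (Σ _ : S, Y) => z.1) := continuous_sigma fun _ => continuous_const
  have hi : Continuous (fun z : Y × S => (⟨z.2, z.1⟩ : Σ _ : S, Y)) :=
    continuous_prod_of_discrete_right.mpr fun s => continuous_sigmaMk (σ := fun _ : S => Y) (i := s)
  intro y
  refine IsEvenlyCovered.to_isEvenlyCovered_preimage (I := S)
    ⟨inferInstance, Set.univ, trivial, isOpen_univ, isOpen_univ,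
      { toFun := fun z => (⟨z.1.2, trivial⟩, z.1.1)
        invFun := fun z => ⟨⟨z.2, z.1.1⟩, trivial⟩
        left_inv := fun _ => rfl
        right_inv := fun _ => rfl
        continuous_toFun := ?_
        continuous_invFun := ?_ }, fun _ => rfl⟩
  · exact ((hc.comp continuous_subtype_val).subtype_mk _).prodMk (hs.comp continuous_subtype_val)
  · exact (hi.comp ((continuous_subtype_val.comp continuous_fst).prodMk continuous_snd)).subtype_mk _

/-- The covering `c · Y` of `Y`, the disjoint union of copies of `Y` indexed by a set `S` of
cardinality `c`. -/
def copies (S : Type u) (Y : Type u) [TopologicalSpace Y] : Cov Y where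
  total := Σ _ : S, Y
  proj z := z.2
  isCoveringMap := isCoveringMap_copies S Y

/-- A covering is trivial if it is isomorphic to `c · Y` for some cardinal `c`. -/
def IsTrivial {Y : Type u} [TopologicalSpace Y] (E : Cov Y) : Prop :=
  ∃ S : Type u, Nonempty (E ≅ copies S Y)

variable {X Y : Type u} [TopologicalSpace X] [TopologicalSpace Y]

/-- The pullback of a covering map is a covering map. -/
theorem isCoveringMap_pullback (f : C(X, Y)) (E : Cov Y) :
    IsCoveringMap (fun z : {z : X × E.total // f z.1 = E.proj z.2} => z.1.1) := by
  intro x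
  obtain ⟨hd, U, hxU, hU, -, H, hH⟩ := E.isCoveringMap (f x)
  have hU' : IsOpen (f ⁻¹' U) := hU.preimage f.continuous
  have hH' : ∀ w, E.proj (H.symm w).1 = w.1.1 := fun w => by
    rw [← hH, Homeomorph.apply_symm_apply]
  refine IsEvenlyCovered.to_isEvenlyCovered_preimage (I := E.proj ⁻¹' {f x})
    ⟨hd, f ⁻¹' U, hxU, hU', hU'.preimage (continuous_fst.comp continuous_subtype_val),
      { toFun := fun z => (⟨z.1.1.1, z.2⟩, (H ⟨z.1.1.2, by
          have h := z.2
          simpa only [Set.mem_preimage, z.1.2] using h⟩).2)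
        invFun := fun w => ⟨⟨(w.1.1, (H.symm (⟨f w.1.1, w.1.2⟩, w.2)).1), (hH' (⟨f w.1.1, w.1.2⟩, w.2)).symm⟩, w.1.2⟩
        left_inv := ?_
        right_inv := ?_
        continuous_toFun := by fun_prop
        continuous_invFun := ?_ }, fun _ => rfl⟩
  · rintro ⟨⟨⟨a, e⟩, (h : f a = E.proj e)⟩, (ha : f a ∈ U)⟩
    have he : e ∈ E.proj ⁻¹' U := by
      change E.proj e ∈ U
      rwa [← h]
    have hw : ((⟨f a, ha⟩ : U), (H ⟨e, he⟩).2) = H ⟨e, he⟩ :=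
      Prod.ext (Subtype.ext (h.trans (hH ⟨e, he⟩).symm)) rfl
    refine Subtype.ext (Subtype.ext (Prod.ext rfl ?_))
    change (H.symm (⟨f a, ha⟩, (H ⟨e, he⟩).2)).1 = e
    rw [hw, Homeomorph.symm_apply_apply]
  · rintro ⟨⟨a, ha⟩, s⟩
    exact Prod.ext rfl (by simp)
  · have h₁ : Continuous fun w : (f ⁻¹' U) × (E.proj ⁻¹' {f x}) =>
        ((⟨f w.1.1, w.1.2⟩ : U), w.2) := by fun_prop
    exact ((by fun_prop : Continuous fun w : (f ⁻¹' U) × (E.proj ⁻¹' {f x}) => w.1.1).prodMk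
      (continuous_subtype_val.comp (H.symm.continuous.comp h₁))).subtype_mk _ |>.subtype_mk _

/-- The topological pullback functor `f* : Cov(Y) ⥤ Cov(X)`: on objects the subspace
`{(x, e) | f x = p e}` of `X × E` with the first projection, on morphisms the restriction
of `id × t`. -/
def pullback (f : C(X, Y)) : Cov Y ⥤ Cov X where
  obj E :=
    { total := {z : X × E.total // f z.1 = E.proj z.2}
      proj := fun z => z.1.1
      isCoveringMap := isCoveringMap_pullback f E }
  map {E₁ E₂} t :=
    { map :=
        { toFun := fun z => ⟨(z.1.1, t.map z.1.2), z.2.trans (t.comm _).symm⟩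
          continuous_toFun := by fun_prop }
      comm := fun _ => rfl }

/-- A functor between categories of coverings has nullity zero if it sends only trivial coverings
to trivial coverings. -/
def NullityZero (F : Cov Y ⥤ Cov X) : Prop :=
  ∀ E : Cov Y, (F.obj E).IsTrivial → E.IsTrivial

end Cov

-- Let `N` be the normal closure of `H`. A section of `f*E` through `(x₀, e)` carries each loop of
-- `X` to a closed lift at `e` of its image in `Y`, so triviality of `f*E` puts `H` in the kernel of
-- the monodromy of `E` at `y₀` (`range_le_ker_monodromyPerm`). Kernels are normal, so this one
-- contains `N`; if `N` is everything, then `E` has trivial monodromy and is trivial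
-- (`isTrivial_of_ker_monodromyPerm_eq_top`).
--
-- Conversely, `cosetFunctor N` yields a covering with fibre `π₁(Y, y₀)/N` over `y₀`
-- (`isCoveringMap_proj`). As `N` is normal and contains `H`, loops of `X` act trivially on this
-- fibre, so the pullback is trivial. Nullity zero makes the covering itself trivial, all loops fix
-- the coset of `1`, and `N` is everything.

universe v w

/-! ### Transport in functors on the fundamental groupoid. -/

namespace FundamentalGroupoid

variable {Y : Type u} [TopologicalSpace Y] (F : FundamentalGroupoid Y ⥤ Type v)

/-- The action of a path on the fibres of a functor on the fundamental groupoid. -/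
def transport {x y : Y} (γ : Path x y) (a : F.obj ⟨x⟩) : F.obj ⟨y⟩ :=
  F.map (fromPath (Path.Homotopic.Quotient.mk γ)) a

theorem transport_congr {x y : Y} {γ δ : Path x y} (h : γ.Homotopic δ) (a : F.obj ⟨x⟩) :
    transport F γ a = transport F δ a := by
  unfold transport
  rw [(fromPath_eq_iff_homotopic γ δ).2 h]

theorem transport_refl {x : Y} (a : F.obj ⟨x⟩) : transport F (Path.refl x) a = a :=
  Functor.map_id_apply F _ a

theorem transport_trans {x y z : Y} (γ : Path x y) (δ : Path y z) (a : F.obj ⟨x⟩) :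
    transport F (γ.trans δ) a = transport F δ (transport F γ a) :=
  Functor.map_comp_apply F (fromPath (.mk γ)) (fromPath (.mk δ)) a

theorem transport_symm_transport {x y : Y} (γ : Path x y) (a : F.obj ⟨x⟩) :
    transport F γ.symm (transport F γ a) = a := by
  rw [← transport_trans, transport_congr F (Path.Homotopic.trans_symm γ), transport_refl]

theorem transport_transport_symm {x y : Y} (γ : Path x y) (b : F.obj ⟨y⟩) :
    transport F γ (transport F γ.symm b) = b := by
  rw [← transport_trans, transport_congr F (Path.Homotopic.symm_trans γ), transport_refl]

/-- If all loops at `a₀` act trivially on `s`, transport of `s` from `a₀` is path independent. -/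
theorem transport_map_transport_map {A : Type w} [TopologicalSpace A] (f : C(A, Y)) {a₀ : A}
    {s : F.obj ⟨f a₀⟩} (hs : ∀ γ : Path a₀ a₀, transport F (γ.map f.continuous) s = s)
    {a b : A} (p : Path a₀ a) (q : Path a₀ b) (γ : Path a b) :
    transport F (γ.map f.continuous) (transport F (p.map f.continuous) s) =
      transport F (q.map f.continuous) s := by
  -- This loop at `a₀` fixes `s`; transporting along `q` then gives the claim.
  have h := hs ((p.trans γ).trans q.symm)
  rw [Path.map_trans, Path.map_trans, transport_trans, transport_trans, ← Path.map_symm] at h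
  conv_rhs => rw [← h]
  rw [transport_transport_symm]

/-- The total space of the family of sets given by a functor on the fundamental groupoid. -/
structure MonodromySpace : Type max u v where
  /-- the underlying point of the base -/
  base : Y
  /-- the point of the fibre -/
  fiber : F.obj ⟨base⟩

/-! ### The covering space of such a functor. -/

namespace MonodromySpace

/-- A set is open if with each point it contains the transports of this point along all
sufficiently small paths. -/
instance : TopologicalSpace (MonodromySpace F) where
  IsOpen W := ∀ y a, (⟨y, a⟩ : MonodromySpace F) ∈ W → ∃ V ∈ 𝓝 y, ∀ z (γ : Path y z),
    (∀ t, γ t ∈ V) → (⟨z, transport F γ a⟩ : MonodromySpace F) ∈ W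
  isOpen_univ _ _ _ := ⟨Set.univ, Filter.univ_mem, fun _ _ _ => trivial⟩
  isOpen_inter W W' hW hW' y a h := by
    obtain ⟨V, hV, H⟩ := hW y a h.1
    obtain ⟨V', hV', H'⟩ := hW' y a h.2
    exact ⟨V ∩ V', Filter.inter_mem hV hV', fun z γ hγ =>
      ⟨H z γ fun t => (hγ t).1, H' z γ fun t => (hγ t).2⟩⟩
  isOpen_sUnion S hS y a := by
    rintro ⟨W, hW, h⟩
    obtain ⟨V, hV, H⟩ := hS W hW y a h
    exact ⟨V, hV, fun z γ hγ => ⟨W, hW, H z γ hγ⟩⟩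

variable {F}

theorem isOpen_iff {W : Set (MonodromySpace F)} :
    IsOpen W ↔ ∀ y a, (⟨y, a⟩ : MonodromySpace F) ∈ W → ∃ V ∈ 𝓝 y, ∀ z (γ : Path y z),
      (∀ t, γ t ∈ V) → (⟨z, transport F γ a⟩ : MonodromySpace F) ∈ W :=
  Iff.rfl

/-- The projection to the base. -/
def proj (e : MonodromySpace F) : Y := e.base

theorem continuous_proj : Continuous (proj (F := F)) where
  isOpen_preimage U hU := isOpen_iff.2 fun y _ hy =>
    ⟨U, hU.mem_nhds hy, fun z γ hγ => by simpa using! hγ 1⟩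

/-- A lift which is parallel along all paths is continuous. -/
theorem continuous_mk_of_transport_eq {A : Type w} [TopologicalSpace A]
    [LocallyPathConnectedSpace A] (f : C(A, Y)) (s : ∀ a, F.obj ⟨f a⟩)
    (hs : ∀ a b (γ : Path a b), transport F (γ.map f.continuous) (s a) = s b) :
    Continuous (fun a => (⟨f a, s a⟩ : MonodromySpace F)) where
  isOpen_preimage W hW := by
    refine isOpen_iff_mem_nhds.2 fun a ha => ?_
    obtain ⟨V, hV, H⟩ := isOpen_iff.1 hW (f a) (s a) ha
    obtain ⟨P, ⟨hP, hPc⟩, hPV⟩ :=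
      (path_connected_basis a).mem_iff.1 (f.continuous.continuousAt hV)
    refine Filter.mem_of_superset hP fun b hb => ?_
    obtain ⟨γ, hγ⟩ := hPc.joinedIn a (mem_of_mem_nhds hP) b hb
    have := H (f b) (γ.map f.continuous) fun t => hPV (hγ t)
    rwa [hs] at this

/-- Over a path-connected open `U` around `y` whose loops at `y` contract in the base, transport
along paths in `U` depends only on the endpoints. This identifies the part over `U` with `U × F(y)`.
-/
theorem isCoveringMap_proj [LocallyPathConnectedSpace Y] [SemilocallySimplyConnectedSpace Y] :
    IsCoveringMap (proj (F := F)) := by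
  intro y
  obtain ⟨U₀, hU₀, hloop⟩ := SemilocallySimplyConnectedSpace.exists_nhds y
  obtain ⟨U, hUo, hyU, hUU₀, hUc⟩ : ∃ U : Set Y, IsOpen U ∧ y ∈ U ∧ U ⊆ U₀ ∧ IsPathConnected U := by
    have hy : y ∈ interior U₀ := mem_interior_iff_mem_nhds.2 hU₀
    exact ⟨pathComponentIn (interior U₀) y, isOpen_interior.pathComponentIn y,
      mem_pathComponentIn_self hy, pathComponentIn_subset.trans interior_subset,
      isPathConnected_pathComponentIn hy⟩
  choose g hg using fun z (hz : z ∈ U) => hUc.joinedIn y hyU z hz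
  have coh : ∀ (z w : U) (γ : Path z.1 w.1), (∀ t, γ t ∈ U) → ∀ a : F.obj ⟨y⟩,
      transport F γ (transport F (g z z.2) a) = transport F (g w w.2) a := by
    intro z w γ hγ a
    have hl := hloop (((g z z.2).trans γ).trans (g w w.2).symm) fun t => hUU₀ ?_
    · have := transport_congr F hl a
      rw [transport_refl, transport_trans, transport_trans] at this
      conv_rhs => rw [← this]
      rw [transport_transport_symm]
    · have : Set.range (((g z z.2).trans γ).trans (g w w.2).symm) ⊆ U := by
        rw [Path.trans_range, Path.trans_range, Path.symm_range]
        exact Set.union_subset (Set.union_subset (Set.range_subset_iff.2 (hg z z.2))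
          (Set.range_subset_iff.2 hγ)) (Set.range_subset_iff.2 (hg w w.2))
      exact this ⟨t, rfl⟩
  let _ : TopologicalSpace (F.obj ⟨y⟩) := ⊥
  have : DiscreteTopology (F.obj ⟨y⟩) := ⟨rfl⟩
  have hU : LocallyPathConnectedSpace U := hUo.locallyPathConnectedSpace
  refine IsEvenlyCovered.to_isEvenlyCovered_preimage (I := F.obj ⟨y⟩)
    ⟨inferInstance, U, hyU, hUo, hUo.preimage continuous_proj,
      { toFun := fun e => (⟨e.1.1, e.2⟩, transport F (g e.1.1 e.2).symm e.1.2)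
        invFun := fun z => ⟨⟨z.1.1, transport F (g z.1.1 z.1.2) z.2⟩, z.1.2⟩
        left_inv := ?_
        right_inv := ?_
        continuous_toFun := ?_
        continuous_invFun := ?_ }, fun _ => rfl⟩
  · rintro ⟨⟨z, b⟩, hz⟩
    exact Subtype.ext (congrArg (MonodromySpace.mk z) (transport_transport_symm F _ b))
  · rintro ⟨⟨z, hz⟩, a⟩
    exact Prod.ext rfl (transport_symm_transport F _ a)
  · refine ((continuous_proj.comp continuous_subtype_val).subtype_mk _).prodMk
      (continuous_discrete_rng.2 fun a => ?_)
    -- The sheet through `a`: all transports of `a` inside `U`. It is open because transport along a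
    -- path in `U` stays in it, by `coh`.
    have hW : IsOpen {e : MonodromySpace F | ∃ h : e.1 ∈ U, transport F (g e.1 h) a = e.2} := by
      refine isOpen_iff.2 ?_
      rintro z b ⟨(hz : z ∈ U), (hb : transport F (g z hz) a = b)⟩
      subst hb
      refine ⟨U, hUo.mem_nhds hz, fun w γ hγ => ?_⟩
      have hw : w ∈ U := by simpa using hγ 1
      exact ⟨hw, (coh ⟨z, hz⟩ ⟨w, hw⟩ γ hγ a).symm⟩
    convert hW.preimage continuous_subtype_val using 1
    ext ⟨⟨z, b⟩, hz⟩
    constructor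
    · intro (h : transport F (g z hz).symm b = a)
      exact ⟨hz, by rw [← h]; exact transport_transport_symm F _ b⟩
    · rintro ⟨_, h⟩
      change transport F (g z hz) a = b at h
      change transport F (g z hz).symm b = a
      rw [← h, transport_symm_transport]
  · refine Continuous.subtype_mk (continuous_prod_of_discrete_right.2 fun a => ?_) _
    refine continuous_mk_of_transport_eq (⟨Subtype.val, continuous_subtype_val⟩ : C(U, Y))
      (fun z => transport F (g z.1 z.2) a) fun z w γ => ?_
    exact coh z w (γ.map continuous_subtype_val) (fun t => (γ t).2) a

/-- Continuous lifts of maps from simply connected spaces are parallel. -/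
theorem transport_eq_of_continuous [LocallyPathConnectedSpace Y]
    [SemilocallySimplyConnectedSpace Y] {A : Type w} [TopologicalSpace A]
    [SimplyConnectedSpace A] [LocallyPathConnectedSpace A] (f : C(A, Y)) (s : ∀ a, F.obj ⟨f a⟩)
    (hs : Continuous (fun a => (⟨f a, s a⟩ : MonodromySpace F))) {a b : A} (γ : Path a b) :
    transport F (γ.map f.continuous) (s a) = s b := by
  have htriv : ∀ δ : Path a a, transport F (δ.map f.continuous) (s a) = s a := fun δ => by
    rw [transport_congr F ((SimplyConnectedSpace.paths_homotopic δ (Path.refl a)).map f)]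
    exact transport_refl F _
  have key : ∀ c (p q : Path a c), transport F (p.map f.continuous) (s a) =
      transport F (q.map f.continuous) (s a) := fun c p q =>
    transport_congr F ((SimplyConnectedSpace.paths_homotopic p q).map f) _
  -- Transporting `s a` to all of `A` gives a second continuous lift of `f`; uniqueness of lifts
  -- identifies it with `s`.
  have hc := continuous_mk_of_transport_eq (F := F) f
    (fun c => transport F ((PathConnectedSpace.somePath a c).map f.continuous) (s a))
    fun c d δ => transport_map_transport_map F f htriv _ _ δ
  have heq := isCoveringMap_proj.eq_of_comp_eq hc hs rfl a (congrArg (MonodromySpace.mk (f a)) (by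
    rw [key a _ (Path.refl a)]
    exact transport_refl F _))
  have := congrFun heq b
  rw [key b γ (PathConnectedSpace.somePath a b)]
  exact eq_of_heq (MonodromySpace.mk.inj this).2

/-- Continuous sections are parallel along all paths. -/
theorem transport_eq_of_continuous_section [LocallyPathConnectedSpace Y]
    [SemilocallySimplyConnectedSpace Y] (s : ∀ y, F.obj ⟨y⟩)
    (hs : Continuous (fun y => (⟨y, s y⟩ : MonodromySpace F))) {x y : Y} (γ : Path x y) :
    transport F γ (s x) = s y := by
  have : ContractibleSpace unitInterval := (convex_Icc (0 : ℝ) 1).contractibleSpace ⟨0, by simp⟩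
  have : LocallyPathConnectedSpace unitInterval := (convex_Icc (0 : ℝ) 1).locallyPathConnectedSpace
  have h := transport_eq_of_continuous (F := F) (A := unitInterval) γ (fun t => s (γ t))
    (hs.comp γ.continuous) (a := 0) (b := 1) ⟨ContinuousMap.id unitInterval, rfl, rfl⟩
  -- `h` concerns a path from `γ 0` to `γ 1`, which equal `x` and `y` only propositionally.
  have aux : ∀ {x' y'} (hx : x' = x) (hy : y' = y),
      transport F (γ.cast hx hy) (s x') = s y' → transport F γ (s x) = s y := by
    rintro _ _ rfl rfl h
    exact h
  exact aux γ.source γ.target h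

end MonodromySpace

end FundamentalGroupoid

/-! ### The coset functor of a vertex subgroup. -/

namespace CategoryTheory.Groupoid

variable {C : Type u} [Groupoid.{v} C] {c : C} (N : Subgroup (End c))

/-- Two morphisms out of `c` are equivalent if they differ by an element of `N`. -/
def cosetSetoid (d : C) : Setoid (c ⟶ d) where
  r p q := (p ≫ Groupoid.inv q : End c) ∈ N
  iseqv :=
    { refl := fun p => by
        rw [Groupoid.comp_inv]
        exact N.one_mem
      symm := fun {p q} h => by
        have h' := N.inv_mem h
        have heq : (q ≫ Groupoid.inv p : End c) = (p ≫ Groupoid.inv q : End c)⁻¹ := by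
          refine (inv_eq_of_mul_eq_one_left (G := End c) ?_).symm
          change (p ≫ Groupoid.inv q) ≫ q ≫ Groupoid.inv p = 𝟙 c
          simp
        rw [heq]
        exact h'
      trans := fun {p q r} h h' => by
        have heq : (p ≫ Groupoid.inv r : c ⟶ c) =
            (p ≫ Groupoid.inv q) ≫ q ≫ Groupoid.inv r := by simp
        rw [heq]
        -- Multiplication in `End c` is composition in the reverse order of `≫`.
        exact N.mul_mem h' h }

/-- The functor of morphisms out of `c` modulo the subgroup `N`. -/
def cosetFunctor : C ⥤ Type v where
  obj d := _root_.Quotient (cosetSetoid N d)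
  map {d d'} γ := ↾(_root_.Quotient.map (· ≫ γ) fun p q h => by
    change (p ≫ γ) ≫ Groupoid.inv (q ≫ γ) ∈ N
    have : (p ≫ γ) ≫ Groupoid.inv (q ≫ γ) = p ≫ Groupoid.inv q := by
      simp [Groupoid.inv_eq_inv]
    rw [this]
    exact h)
  map_id d := by
    ext ⟨p⟩
    exact congrArg (_root_.Quotient.mk _) (Category.comp_id p)
  map_comp γ δ := by
    ext ⟨p⟩
    exact congrArg (_root_.Quotient.mk _) (Category.assoc p γ δ).symm

/-- Moving the class of `p` by `γ` changes it by a conjugate of `γ`, which is where normality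
enters. -/
theorem cosetFunctor_map_eq_self [N.Normal] {γ : End c} (hγ : γ ∈ N)
    (a : (cosetFunctor N).obj c) : (cosetFunctor N).map γ a = a := by
  obtain ⟨p⟩ := a
  refine _root_.Quotient.sound ?_
  change (p ≫ γ) ≫ Groupoid.inv p ∈ N
  have := ‹N.Normal›.conj_mem γ hγ (Groupoid.inv p : End c)
  have hinv : ((Groupoid.inv p : End c))⁻¹ = p :=
    inv_eq_of_mul_eq_one_left (G := End c) (Groupoid.inv_comp p)
  rw [hinv] at this
  rw [Category.assoc]
  exact this

theorem mem_of_cosetFunctor_map_eq_self {γ : End c}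
    (h : (cosetFunctor N).map γ (_root_.Quotient.mk (cosetSetoid N c) (𝟙 c)) =
      _root_.Quotient.mk (cosetSetoid N c) (𝟙 c)) : γ ∈ N := by
  have h' : (𝟙 c ≫ γ) ≫ Groupoid.inv (𝟙 c) ∈ N := _root_.Quotient.exact h
  simpa [Groupoid.inv_eq_inv] using h'

end CategoryTheory.Groupoid

/-! ### Trivial coverings, sections and monodromy. -/

namespace Cov

/-- A covering which has sections through all points of one fibre is trivial. -/
theorem isTrivial_of_forall_exists_section {Y : Type u} [TopologicalSpace Y] [ConnectedSpace Y]
    [LocallyPathConnectedSpace Y] (E : Cov Y) (y₀ : Y)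
    (h : ∀ e, E.proj e = y₀ → ∃ s : C(Y, E.total), s y₀ = e ∧ ∀ y, E.proj (s y) = y) :
    E.IsTrivial := by
  have : PathConnectedSpace Y := pathConnectedSpace_iff_connectedSpace.2 inferInstance
  choose s hs₀ hs using h
  let g : (copies (E.proj ⁻¹' {y₀}) Y).total → E.total := fun z => s z.1.1 z.1.2 z.2
  have hg : Continuous g := continuous_sigma fun e => (s e.1 e.2).continuous
  have hproj : E.proj ∘ g = (copies (E.proj ⁻¹' {y₀}) Y).proj := funext fun z => hs _ _ _
  have hloc : IsLocalHomeomorph g :=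
    .of_comp (hproj ▸ (copies (E.proj ⁻¹' {y₀}) Y).isCoveringMap.isLocalHomeomorph)
      E.isCoveringMap.isLocalHomeomorph hg
  have hinj : Function.Injective g := by
    rintro ⟨e, y⟩ ⟨e', y'⟩ hee
    have hy : y = y' := by
      rw [← hs e.1 e.2 y, ← hs e'.1 e'.2 y']
      exact congrArg E.proj hee
    subst hy
    have hss := E.isCoveringMap.eq_of_comp_eq (s e.1 e.2).continuous (s e'.1 e'.2).continuous
      (funext fun z => (hs e.1 e.2 z).trans (hs e'.1 e'.2 z).symm) y hee
    have he : e = e' := Subtype.ext (by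
      rw [← hs₀ e.1 e.2, ← hs₀ e'.1 e'.2]
      exact congrFun hss y₀)
    rw [he]
  have hsurj : Function.Surjective g := by
    intro e
    let γ := PathConnectedSpace.somePath (E.proj e) y₀
    let Γ := E.isCoveringMap.liftPath γ e γ.source
    have hΓ : ∀ t, E.proj (Γ t) = γ t := congrFun (E.isCoveringMap.liftPath_lifts γ e γ.source)
    have hΓ₀ : Γ 0 = e := E.isCoveringMap.liftPath_zero γ e γ.source
    have h₁ : E.proj (Γ 1) = y₀ := (hΓ 1).trans γ.target
    have heq := E.isCoveringMap.eq_of_comp_eq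
      ((s (Γ 1) h₁).continuous.comp γ.continuous) Γ.continuous
      -- The two lifts of `γ` agree at time `1`, over `y₀`; the value needed is at time `0`, where
      -- `Γ` is `e`.
      (funext fun t => (hs _ _ _).trans (hΓ t).symm) 1 (by
        change s (Γ 1) h₁ (γ 1) = Γ 1
        rw [γ.target, hs₀])
    refine ⟨⟨⟨Γ 1, h₁⟩, E.proj e⟩, ?_⟩
    have h0 := congrFun heq 0
    change s (Γ 1) h₁ (γ 0) = Γ 0 at h0
    rwa [γ.source, hΓ₀] at h0
  let φ : (copies (E.proj ⁻¹' {y₀}) Y).total ≃ₜ E.total :=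
    (Equiv.ofBijective g ⟨hinj, hsurj⟩).toHomeomorphOfContinuousOpen hg hloc.isOpenMap
  refine ⟨E.proj ⁻¹' {y₀}, ⟨⟨⟨⟨φ.symm, φ.symm.continuous⟩, fun e => ?_⟩,
    ⟨⟨φ, φ.continuous⟩, congrFun hproj⟩, ?_, ?_⟩⟩⟩
  · have := congrFun hproj (φ.symm e)
    exact this.symm.trans (congrArg E.proj (φ.apply_symm_apply e))
  · exact Hom.ext (ContinuousMap.ext φ.apply_symm_apply)
  · exact Hom.ext (ContinuousMap.ext φ.symm_apply_apply)

/-- A trivial covering has sections through all points. -/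
theorem IsTrivial.exists_section {Y : Type u} [TopologicalSpace Y] {E : Cov Y} (h : E.IsTrivial)
    (e : E.total) : ∃ s : C(Y, E.total), s (E.proj e) = e ∧ ∀ y, E.proj (s y) = y := by
  obtain ⟨S, ⟨φ⟩⟩ := h
  let z : Σ _ : S, Y := φ.hom.map e
  have hz : z.2 = E.proj e := φ.hom.comm e
  refine ⟨⟨fun y => φ.inv.map (⟨z.1, y⟩ : Σ _ : S, Y), φ.inv.map.continuous.comp
    (continuous_sigmaMk (σ := fun _ : S => Y))⟩, ?_, fun y => φ.inv.comm _⟩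
  change φ.inv.map (⟨z.1, E.proj e⟩ : Σ _ : S, Y) = e
  rw [← hz]
  exact congrArg (fun t : Hom E E => t.map e) φ.hom_inv_id

variable {X Y : Type u} [TopologicalSpace X] [TopologicalSpace Y]

/-- The image of the fundamental group of `X` acts trivially on the fibre of a covering whose
pullback to `X` is trivial. -/
theorem range_le_ker_monodromyPerm (f : C(X, Y)) (x₀ : X) (E : Cov Y)
    (h : ((pullback f).obj E).IsTrivial) :
    (FundamentalGroup.map f x₀).range ≤ (E.isCoveringMap.monodromyPerm (f x₀)).ker := by
  rintro _ ⟨γ, rfl⟩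
  refine Equiv.ext fun e => ?_
  obtain ⟨e, he⟩ := e
  let z : ((pullback f).obj E).total := ⟨(x₀, e), he.symm⟩
  obtain ⟨s, hs₀, hs⟩ := h.exists_section z
  have hσ : ∀ x, E.proj (s x).1.2 = f x := fun x =>
    (s x).2.symm.trans (congrArg f (hs x))
  have hσ₀ : (s x₀).1.2 = e := congrArg (fun z => z.1.2) hs₀
  induction γ using Quotient.ind with | _ γ =>
  refine Subtype.ext ?_
  change E.isCoveringMap.liftPath (γ.map f.continuous) e _ 1 = e
  let Γ : C(unitInterval, E.total) :=
    ⟨fun t => (s (γ t)).1.2, by fun_prop⟩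
  have hΓ : Γ = E.isCoveringMap.liftPath (γ.map f.continuous) e
      ((γ.map f.continuous).source.trans he.symm) :=
    (E.isCoveringMap.eq_liftPath_iff' _).2 ⟨funext fun t => hσ (γ t), by
      change (s (γ 0)).1.2 = e
      rw [γ.source, hσ₀]⟩
  rw [← hΓ]
  change (s (γ 1)).1.2 = e
  rw [γ.target, hσ₀]

/-- A covering with trivial monodromy is trivial. -/
theorem isTrivial_of_ker_monodromyPerm_eq_top [ConnectedSpace Y] [LocallyPathConnectedSpace Y]
    (E : Cov Y) (y₀ : Y) (h : (E.isCoveringMap.monodromyPerm y₀).ker = ⊤) : E.IsTrivial := by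
  have : PathConnectedSpace Y := pathConnectedSpace_iff_connectedSpace.2 inferInstance
  refine E.isTrivial_of_forall_exists_section y₀ fun e he => ?_
  obtain ⟨s, ⟨hs₀, hs⟩, -⟩ := E.isCoveringMap.existsUnique_continuousMap_lifts_of_range_le
    -- A section is a lift of the identity; the lifting criterion holds because every loop at `y₀`
    -- lifts to a loop at `e`.
    (f := ContinuousMap.id Y) (a₀ := y₀) (e₀ := e) he (fun γ _ => by
      have hγ : γ ∈ (E.isCoveringMap.monodromyPerm y₀).ker := h ▸ Subgroup.mem_top _
      have hγe : E.isCoveringMap.monodromy γ ⟨e, he⟩ = ⟨e, he⟩ :=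
        congrArg (fun σ : Equiv.Perm _ => σ ⟨e, he⟩) hγ
      refine ⟨(E.isCoveringMap.liftPathQuotient γ ⟨e, he⟩).cast rfl
        (congrArg Subtype.val hγe).symm, ?_⟩
      refine (FundamentalGroup.mapOfEq_apply _ _ _).trans ?_
      rw [Path.Homotopic.Quotient.map_cast, E.isCoveringMap.map_liftPathQuotient]
      refine (Path.Homotopic.Quotient.cast_cast _ _ _ _ _).trans ?_
      refine (Path.Homotopic.Quotient.cast_cast _ _ _ _ _).trans ?_
      exact Path.Homotopic.Quotient.cast_rfl_rfl γ)
  exact ⟨s, hs₀, congrFun hs⟩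

/-! ### Triviality of coverings given by functors. -/

open FundamentalGroupoid CategoryTheory.Groupoid

/-- The covering of `Y` associated to a functor on the fundamental groupoid. -/
def ofFunctor [LocallyPathConnectedSpace Y] [SemilocallySimplyConnectedSpace Y]
    (F : FundamentalGroupoid Y ⥤ Type u) : Cov Y where
  total := MonodromySpace F
  proj := MonodromySpace.proj
  isCoveringMap := MonodromySpace.isCoveringMap_proj

/-- The pullback of the covering associated to a functor is trivial if the loops of `X` act
trivially. -/
theorem isTrivial_pullback_ofFunctor [ConnectedSpace X] [LocallyPathConnectedSpace X]
    [LocallyPathConnectedSpace Y] [SemilocallySimplyConnectedSpace Y]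
    (F : FundamentalGroupoid Y ⥤ Type u) (f : C(X, Y)) (x₀ : X)
    (h : ∀ (γ : Path x₀ x₀) (a : F.obj ⟨f x₀⟩), transport F (γ.map f.continuous) a = a) :
    ((pullback f).obj (ofFunctor F)).IsTrivial := by
  have : PathConnectedSpace X := pathConnectedSpace_iff_connectedSpace.2 inferInstance
  refine isTrivial_of_forall_exists_section _ x₀ ?_
  rintro ⟨⟨x, ⟨y, a⟩⟩, hxy⟩ hx
  change x = x₀ at hx
  change f x = y at hxy
  subst hx hxy
  let p : ∀ b, Path x b := fun b => PathConnectedSpace.somePath x b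
  refine ⟨⟨fun b => ⟨(b, ⟨f b, transport F ((p b).map f.continuous) a⟩), rfl⟩,
    (continuous_id.prodMk (MonodromySpace.continuous_mk_of_transport_eq f _ fun b c γ =>
      transport_map_transport_map F f (fun γ => h γ a) (p b) (p c) γ)).subtype_mk _⟩,
    ?_, fun b => rfl⟩
  refine Subtype.ext (Prod.ext rfl (congrArg (MonodromySpace.mk (f x)) (h (p x) a)))

/-- If the covering associated to a functor is trivial, then loops act trivially. -/
theorem transport_eq_self_of_isTrivial_ofFunctor [LocallyPathConnectedSpace Y]
    [SemilocallySimplyConnectedSpace Y] {F : FundamentalGroupoid Y ⥤ Type u}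
    (h : (ofFunctor F).IsTrivial) {y : Y} (γ : Path y y) (a : F.obj ⟨y⟩) :
    transport F γ a = a := by
  obtain ⟨s, hs₀, hs⟩ := h.exists_section (⟨y, a⟩ : MonodromySpace F)
  -- Rewrites the section as a dependent family of fibre points, so that transport applies.
  obtain ⟨σ, hσ⟩ : ∃ σ : ∀ y, F.obj ⟨y⟩, ∀ y, s y = (⟨y, σ y⟩ : MonodromySpace F) := by
    have : ∀ y, ∃ b : F.obj ⟨y⟩, s y = (⟨y, b⟩ : MonodromySpace F) := fun y => by
      have hy : MonodromySpace.proj (s y) = y := hs y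
      generalize s y = e at hy
      obtain ⟨z, b⟩ := e
      change z = y at hy
      subst hy
      exact ⟨b, rfl⟩
    choose σ hσ using this
    exact ⟨σ, hσ⟩
  have hc : Continuous (fun y => (⟨y, σ y⟩ : MonodromySpace F)) := by
    have := s.continuous
    rwa [show (s : Y → _) = _ from funext hσ] at this
  have ha : σ y = a :=
    eq_of_heq (MonodromySpace.mk.inj ((hσ y).symm.trans hs₀)).2
  rw [← ha]
  exact MonodromySpace.transport_eq_of_continuous_section σ hc γ

end Cov

theorem mainTheorem2 {X Y : Type u} [TopologicalSpace X] [TopologicalSpace Y]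
    [ConnectedSpace X] [LocallyPathConnectedSpace X] [SemilocallySimplyConnectedSpace X]
    [ConnectedSpace Y] [LocallyPathConnectedSpace Y] [SemilocallySimplyConnectedSpace Y]
    (f : C(X, Y)) (x₀ : X) :
    Cov.NullityZero (Cov.pullback f) ↔ (FundamentalGroup.map f x₀).range.IsContranormal := by
  constructor
  · intro h
    let N := Subgroup.normalClosure
      ((FundamentalGroup.map f x₀).range : Set (FundamentalGroup Y (f x₀)))
    have hE := h (Cov.ofFunctor (Groupoid.cosetFunctor N))
      (Cov.isTrivial_pullback_ofFunctor _ f x₀ fun γ a =>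
        Groupoid.cosetFunctor_map_eq_self N
          (Subgroup.subset_normalClosure ⟨Path.Homotopic.Quotient.mk γ, rfl⟩) a)
    refine (Subgroup.eq_top_iff' _).2 fun γ => ?_
    induction γ using Quotient.ind with | _ γ =>
    -- The point left implicit is the coset of the identity, whose stabiliser is `N`.
    exact Groupoid.mem_of_cosetFunctor_map_eq_self N
      (Cov.transport_eq_self_of_isTrivial_ofFunctor hE γ _)
  · intro h E hE
    refine E.isTrivial_of_ker_monodromyPerm_eq_top (f x₀) (top_le_iff.1 ?_)
    rw [← h]
    exact Subgroup.normalClosure_le_normal (Cov.range_le_ker_monodromyPerm f x₀ E hE)
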